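/- Let $k$ be an algebraically closed field of characteristic $p>0$, let $\tilde G$ be a finite group, $G$ a normal subgroup of $\tilde G$, and let modules be finitely generated left modules. For a $kG$-module $U$ and $x\in\tilde G$, let $xU$ denote the conjugate $kG$-module, i.e. $U$ with $g\in G$ acting as $x^{-1}gx$ acts on $U$, and let $\operatorname{Ind}_G^{\tilde G}U = k\tilde G\otimes_{kG}U$. For a module $U$ over a finite-dimensional $k$-algebra $\Lambda$, let $P(U)\to U$ be the projective cover, $\Omega(U)$ its kernel (the syzygy), and $\tau U=D\operatorname{Tr}U$ the Auslander–Reiten translate, where $\operatorname{Tr}U$ is the cokernel of $\operatorname{Hom}_\Lambda(P(U),\Lambda)\to\operatorname{Hom}_\Lambda(P(\Omega(U)),\Lambda)$ and $D=\operatorname{Hom}_k(-,k)$. Let $M$ be a $kG$-module such that $xM\cong M$ as $kG$-modules for every $x\in\tilde G$. Then: 1. $xP(M)\cong P(M)$ as $kG$-modules for every $x\in\tilde G$; 2. $x\Omega(M)\cong\Omega(M)$ as $kG$-modules for every $x\in\tilde G$; 3. $\operatorname{Ind}_G^{\tilde G}\Omega(M)\cong\Omega(\operatorname{Ind}_G^{\tilde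 G}M)$ as $k\tilde G$-modules; 4. $\tau(\operatorname{Ind}_G^{\tilde G}M)\cong\operatorname{Ind}_G^{\tilde G}(\tau M)$ as $k\tilde G$-modules. -/

import Mathlib

open scoped TensorProduct

universe u v w

noncomputable section

/-! ### Projective covers and syzygies over a (left) Artinian ring -/

section ProjectiveCover

variable {A : Type u} [Ring A]

/-- `π : P → M` is a projective cover of the left `A`-module `M`: `P` is projective and `π` is an
essential epimorphism, i.e. it is surjective and its kernel is a superfluous submodule of `P`. -/
structure IsProjectiveCover {P : Type v} {M : Type w} [AddCommGroup P] [Module A P]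
    [AddCommGroup M] [Module A M] (π : P →ₗ[A] M) : Prop where
  projective : Module.Projective A P
  surjective : Function.Surjective π
  essential : ∀ N : Submodule A P, N ⊔ LinearMap.ker π = ⊤ → N = ⊤

/-- Finitely generated modules over an Artinian ring have a projective cover, which can be found
inside a free module of finite rank. -/
theorem exists_isProjectiveCover [IsArtinianRing A] (M : Type w) [AddCommGroup M] [Module A M]
    [Module.Finite A M] :
    ∃ (n : ℕ) (N : Submodule A (Fin n → A)) (π : N →ₗ[A] M), IsProjectiveCover π := by
  obtain ⟨n, q, hq⟩ := Module.Finite.exists_fin' A M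
  -- a minimal submodule on which `q` is still surjective
  obtain ⟨N, hN, hmin⟩ := WellFounded.has_min (r := fun a b : Submodule A (Fin n → A) => a < b)
    wellFounded_lt {N : Submodule A (Fin n → A) | N.map q = ⊤}
    ⟨⊤, by simpa [LinearMap.range_eq_top] using hq⟩
  have hmin' : ∀ L : Submodule A (Fin n → A), L ≤ N → L.map q = ⊤ → L = N := fun L hL h =>
    (hL.eq_or_lt).resolve_right (hmin L h)
  have hsurj : Function.Surjective (q.comp N.subtype) := by
    intro m
    have : m ∈ N.map q := by rw [show N.map q = ⊤ from hN]; trivial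
    obtain ⟨y, hy, rfl⟩ := this
    exact ⟨⟨y, hy⟩, rfl⟩
  obtain ⟨f, hf⟩ := Module.projective_lifting_property (q.comp N.subtype) q hsurj
  have hf' : ∀ y, q (f y : Fin n → A) = q y := fun y => LinearMap.congr_fun hf y
  let e : N →ₗ[A] N := f.comp N.subtype
  have hesurj : Function.Surjective e := by
    have h1 : (LinearMap.range (N.subtype.comp e)) = N := by
      apply hmin'
      · rintro _ ⟨y, rfl⟩
        exact (e y).2
      · rw [eq_top_iff]
        rintro m -
        obtain ⟨y, rfl⟩ := hsurj m
        exact ⟨_, ⟨y, rfl⟩, hf' _⟩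
    intro y
    have hy : (y : Fin n → A) ∈ LinearMap.range (N.subtype.comp e) := by rw [h1]; exact y.2
    obtain ⟨z, hz⟩ := hy
    exact ⟨z, Subtype.ext hz⟩
  have hebij : Function.Bijective e :=
    ⟨IsNoetherian.injective_of_surjective_endomorphism e hesurj, hesurj⟩
  let E := LinearEquiv.ofBijective e hebij
  refine ⟨n, N, q.comp N.subtype, ?_, hsurj, ?_⟩
  · refine Module.Projective.of_split (N.subtype.comp E.symm.toLinearMap) f ?_
    ext1 y
    exact E.apply_symm_apply y
  · intro L hL
    have h2 : L.map N.subtype = N := by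
      apply hmin'
      · rintro _ ⟨y, -, rfl⟩
        exact y.2
      · rw [eq_top_iff]
        rintro m -
        obtain ⟨y, rfl⟩ := hsurj m
        have hy : y ∈ L ⊔ LinearMap.ker (q.comp N.subtype) := by rw [hL]; trivial
        obtain ⟨a, ha, b, hb, rfl⟩ := Submodule.mem_sup.1 hy
        refine ⟨_, ⟨a, ha, rfl⟩, ?_⟩
        rw [map_add, LinearMap.mem_ker.1 hb, add_zero]
        rfl
    rw [eq_top_iff]
    rintro y -
    have hy : (y : Fin n → A) ∈ L.map N.subtype := by rw [h2]; exact y.2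
    obtain ⟨z, hz, hzy⟩ := hy
    rwa [← (Subtype.ext hzy : z = y)]

variable (A) [IsArtinianRing A] (M : Type w) [AddCommGroup M] [Module A M] [Module.Finite A M]

/-- The underlying module `P(M)` of a (fixed) projective cover of `M`; it is unique up to
isomorphism. -/
def ProjCover : Type u := (exists_isProjectiveCover (A := A) M).choose_spec.choose

instance : AddCommGroup (ProjCover A M) :=
  inferInstanceAs (AddCommGroup (exists_isProjectiveCover (A := A) M).choose_spec.choose)

instance : Module A (ProjCover A M) :=
  inferInstanceAs (Module A (exists_isProjectiveCover (A := A) M).choose_spec.choose)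

instance : Module.Finite A (ProjCover A M) :=
  inferInstanceAs (Module.Finite A (exists_isProjectiveCover (A := A) M).choose_spec.choose)

/-- The structure map `π_M : P(M) → M`. -/
def projCoverMap : ProjCover A M →ₗ[A] M :=
  (exists_isProjectiveCover (A := A) M).choose_spec.choose_spec.choose

theorem isProjectiveCover_projCoverMap : IsProjectiveCover (projCoverMap A M) :=
  (exists_isProjectiveCover (A := A) M).choose_spec.choose_spec.choose_spec

/-- The syzygy `Ω(M)`, the kernel of `π_M : P(M) → M`. -/
abbrev Syzygy : Type u := LinearMap.ker (projCoverMap A M)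

/-- The map `P₁ = P(Ω(M)) → P(M) = P₀` in the minimal projective presentation
`P₁ → P₀ → M → 0`. -/
def minPresMap : ProjCover A (Syzygy A M) →ₗ[A] ProjCover A M :=
  (LinearMap.ker (projCoverMap A M)).subtype.comp (projCoverMap A (Syzygy A M))

end ProjectiveCover

/-! ### The Auslander–Reiten translate `τ = D Tr` -/

section AuslanderReiten

/-- The functor `Hom_A(-, A)` from left `A`-modules to right `A`-modules, on morphisms.  The right
action on `Hom_A(P, A)` is `(f · a) y = (f y) * a`. -/
def homRegularMap (A : Type u) [Ring A] {P : Type v} {Q : Type w} [AddCommGroup P] [Module A P]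
    [AddCommGroup Q] [Module A Q] (d : P →ₗ[A] Q) : (Q →ₗ[A] A) →ₗ[Aᵐᵒᵖ] (P →ₗ[A] A) where
  toFun f := f.comp d
  map_add' _ _ := rfl
  map_smul' _ _ := rfl

/-- The `k`-dual `D X = Hom_k(X, k)` of a right module `X` over the `k`-algebra `A`. -/
def KDual (k : Type u) [Field k] (X : Type w) [AddCommGroup X] [Module k X] : Type (max u w) :=
  X →ₗ[k] k

instance (k : Type u) [Field k] (X : Type w) [AddCommGroup X] [Module k X] :
    AddCommGroup (KDual k X) :=
  inferInstanceAs (AddCommGroup (X →ₗ[k] k))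

/-- The left `A`-module structure on `D X`, given by `(a • φ) x = φ (x · a)`. -/
instance (k : Type u) [Field k] (A : Type v) [Ring A] [Algebra k A] (X : Type w) [AddCommGroup X]
    [Module k X] [Module Aᵐᵒᵖ X] [IsScalarTower k Aᵐᵒᵖ X] : Module A (KDual k X) where
  smul a φ :=
    { toFun := fun x => (show X →ₗ[k] k from φ) (MulOpposite.op a • x)
      map_add' := fun x y => by rw [smul_add, map_add]
      map_smul' := fun c x => by
        rw [← algebraMap_smul Aᵐᵒᵖ c x, ← mul_smul, ← Algebra.commutes, mul_smul,
          algebraMap_smul, map_smul, RingHom.id_apply] }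
  one_smul φ := LinearMap.ext fun x => congrArg (show X →ₗ[k] k from φ) (one_smul Aᵐᵒᵖ x)
  mul_smul a b φ := LinearMap.ext fun x =>
    congrArg (show X →ₗ[k] k from φ) (mul_smul (MulOpposite.op b) (MulOpposite.op a) x)
  smul_zero _ := rfl
  smul_add _ _ _ := rfl
  add_smul a b φ := LinearMap.ext fun x =>
    (congrArg (show X →ₗ[k] k from φ)
      (add_smul (MulOpposite.op a) (MulOpposite.op b) x)).trans (map_add _ _ _)
  zero_smul φ := LinearMap.ext fun x =>
    (congrArg (show X →ₗ[k] k from φ) (zero_smul Aᵐᵒᵖ x)).trans (map_zero _)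

variable (A : Type u) [Ring A] [IsArtinianRing A]
  (M : Type w) [AddCommGroup M] [Module A M] [Module.Finite A M]

/-- The transpose `Tr M`, a right `A`-module: the cokernel of
`Hom_A(P₀, A) → Hom_A(P₁, A)` for the minimal projective presentation `P₁ → P₀ → M → 0`. -/
abbrev Transpose : Type u :=
  (ProjCover A (Syzygy A M) →ₗ[A] A) ⧸ LinearMap.range (homRegularMap A (minPresMap A M))

/-- The Auslander–Reiten translate `τ M = D Tr M`. -/
abbrev ARTranslate (k : Type v) [Field k] [Algebra k A] : Type (max v u) :=
  KDual k (Transpose A M)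

end AuslanderReiten

/-! ### Tensor products over a noncommutative ring, and induction -/

section Induction

variable {A : Type u} {B : Type v} [Ring A] [Ring B]

/-- The `B`-submodule of `B ⊗_ℤ M` by which one divides in order to obtain `B ⊗_A M`, where `B` is
a right `A`-module through the ring homomorphism `φ : A → B`. -/
def balancingSubmodule (φ : A →+* B) (M : Type w) [AddCommGroup M] [Module A M] :
    Submodule B (B ⊗[ℤ] M) :=
  Submodule.span B {t | ∃ (b : B) (a : A) (m : M), t = (b * φ a) ⊗ₜ[ℤ] m - b ⊗ₜ[ℤ] (a • m)}

/-- The left `B`-module `B ⊗_A M` for a ring homomorphism `φ : A → B` and a left `A`-module `M`. -/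
abbrev BaseChange (φ : A →+* B) (M : Type w) [AddCommGroup M] [Module A M] : Type (max v w) :=
  (B ⊗[ℤ] M) ⧸ balancingSubmodule φ M

instance baseChange_finite (φ : A →+* B) (M : Type w) [AddCommGroup M] [Module A M]
    [Module.Finite A M] : Module.Finite B (BaseChange φ M) := by
  classical
  obtain ⟨s, hs⟩ := (Module.Finite.fg_top : (⊤ : Submodule A M).FG)
  let ι : M → BaseChange φ M := fun m => (balancingSubmodule φ M).mkQ (1 ⊗ₜ[ℤ] m)
  have hι : ∀ (a : A) (m : M), ι (a • m) = φ a • ι m := by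
    intro a m
    symm
    change (balancingSubmodule φ M).mkQ (φ a • (1 ⊗ₜ[ℤ] m)) = _
    rw [TensorProduct.smul_tmul', smul_eq_mul, mul_one, ← sub_eq_zero, ← map_sub]
    refine (Submodule.Quotient.mk_eq_zero _).2 (Submodule.subset_span ⟨1, a, m, ?_⟩)
    rw [one_mul]
  have hadd : ∀ m m' : M, ι (m + m') = ι m + ι m' := fun m m' => by
    simp only [ι, TensorProduct.tmul_add, map_add]
  refine ⟨⟨s.image ι, ?_⟩⟩
  rw [Finset.coe_image, eq_top_iff]
  have hmem : ∀ m : M, ι m ∈ Submodule.span B (ι '' (s : Set M)) := by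
    intro m
    have hm : m ∈ Submodule.span A (s : Set M) := by rw [hs]; trivial
    induction hm using Submodule.span_induction with
    | mem x hx => exact Submodule.subset_span ⟨x, hx, rfl⟩
    | zero => simp [ι]
    | add x y _ _ hx hy => rw [hadd]; exact add_mem hx hy
    | smul a x _ hx => rw [hι]; exact Submodule.smul_mem _ _ hx
  rintro t -
  obtain ⟨t, rfl⟩ := Submodule.mkQ_surjective _ t
  induction t with
  | zero => rw [map_zero]; exact zero_mem _
  | add x y hx hy => rw [map_add]; exact add_mem hx hy
  | tmul b m =>
    have : (balancingSubmodule φ M).mkQ (b ⊗ₜ[ℤ] m) = b • ι m := by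
      change _ = (balancingSubmodule φ M).mkQ (b • (1 ⊗ₜ[ℤ] m))
      rw [TensorProduct.smul_tmul', smul_eq_mul, mul_one]
    rw [this]
    exact Submodule.smul_mem _ _ (hmem m)

end Induction

/-! ### Group algebras -/

section GroupAlgebra

instance groupAlgebra_isArtinianRing (k : Type u) [Field k] (G : Type v) [Group G] [Finite G] :
    IsArtinianRing (MonoidAlgebra k G) :=
  IsArtinianRing.of_finite k (MonoidAlgebra k G)

variable (k : Type u) [Field k] {Gt : Type v} [Group Gt] (G : Subgroup Gt)

/-- The induced module `Ind_G^Gt M = k[Gt] ⊗_{k[G]} M` of a `k[G]`-module `M`. -/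
abbrev Ind (M : Type w) [AddCommGroup M] [Module (MonoidAlgebra k G) M] : Type (max u v w) :=
  BaseChange (MonoidAlgebra.mapDomainRingHom k G.subtype) M

variable {G} in
/-- The conjugate `xM` of a `k[G]`-module `M` by `x : Gt`, where `G` is normal in `Gt`: the same
additive group, on which `g ∈ G` acts as `x⁻¹ * g * x` acts on `M`. -/
@[nolint unusedArguments]
def ConjMod (_x : Gt) (M : Type w) : Type w := M

instance (x : Gt) (M : Type w) [AddCommGroup M] : AddCommGroup (ConjMod x M) :=
  inferInstanceAs (AddCommGroup M)

instance [G.Normal] (x : Gt) (M : Type w) [AddCommGroup M] [Module (MonoidAlgebra k G) M] :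
    Module (MonoidAlgebra k G) (ConjMod x M) :=
  Module.compHom M (MonoidAlgebra.mapDomainRingHom k
    ((MulAut.conjNormal x⁻¹ : MulAut G) : G →* G))

end GroupAlgebra

end

/-!
For `x ∈ G̃` an isomorphism `xM ≅ M` is a map `M → M` that is semilinear over the automorphism of
`kG` given by conjugation with `x`. Projective covers are unique up to isomorphism also along
semilinear isomorphisms, which gives the invariance of `P(M)` and, on kernels, of `Ω(M)`.

For induction, `kG → kG̃` is a Frobenius extension: the restriction of coefficients
`E : kG̃ → kG` and the coset representatives form a Frobenius system. That a `kG̃`-module `N` is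
induced from `M` can then be expressed by a unit `M → N` and a trace `N → M`, and such pairs pass to
kernels, to cokernels, to `Hom(-, A)` and, because a Frobenius system is symmetric in left and right
modules, back to left modules under `k`-duality. Since `G` is normal, induction moreover preserves
superfluous kernels, hence projective covers. So induction commutes with every step in the
construction of `Ω` and of `τ = D Tr`.
-/

noncomputable section

section Superfluous

/-- An element of a lattice with top is superfluous if it can be omitted from every supremum that
is the top element; the essential epimorphisms are those whose kernel is a superfluous submodule. -/
def IsSuperfluous {α : Type*} [SemilatticeSup α] [OrderTop α] (a : α) : Prop :=
  ∀ b : α, b ⊔ a = ⊤ → b = ⊤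

theorem IsSuperfluous.finset_sup {α ι : Type*} [SemilatticeSup α] [BoundedOrder α] (s : Finset ι)
    {f : ι → α} (hf : ∀ i, IsSuperfluous (f i)) : IsSuperfluous (s.sup f) := by
  classical
  induction s using Finset.induction_on with
  | empty => exact fun b hb => by rwa [Finset.sup_empty, sup_bot_eq] at hb
  | insert i s _ ih =>
    intro b hb
    rw [Finset.sup_insert, ← sup_assoc] at hb
    exact hf i b (ih _ hb)

theorem IsSuperfluous.map {A A' : Type*} [Ring A] [Ring A'] {σ : A →+* A'} [RingHomSurjective σ]
    {P Q : Type*} [AddCommGroup P] [Module A P] [AddCommGroup Q] [Module A' Q]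
    {K : Submodule A P} (hK : IsSuperfluous K) (f : P →ₛₗ[σ] Q) : IsSuperfluous (K.map f) := by
  intro N hN
  have comap_eq_top : N.comap f = ⊤ := by
    refine hK _ (eq_top_iff.2 fun p _ => ?_)
    have hp : f p ∈ N ⊔ K.map f := hN ▸ Submodule.mem_top
    obtain ⟨n, hn, _, ⟨x, hx, rfl⟩, hsum⟩ := Submodule.mem_sup.1 hp
    refine Submodule.mem_sup.2 ⟨p - x, ?_, x, hx, sub_add_cancel _ _⟩
    rwa [Submodule.mem_comap, map_sub, ← hsum, add_sub_cancel_right]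
  have map_le : K.map f ≤ N := Submodule.map_le_iff_le_comap.2 (comap_eq_top ▸ le_top)
  rw [← hN, sup_eq_left.2 map_le]

end Superfluous

section ProjectiveCoverUniqueness

theorem projective_semilinear_lifting_property {A A' : Type*} [Ring A] [Ring A'] {σ : A →+* A'}
    {P M N : Type*} [AddCommGroup P] [Module A P] [AddCommGroup M] [Module A' M] [AddCommGroup N]
    [Module A' N] [Module.Projective A P] (f : M →ₗ[A'] N) (g : P →ₛₗ[σ] N)
    (hf : Function.Surjective f) : ∃ h : P →ₛₗ[σ] M, ∀ p, f (h p) = g p := by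
  let _ : Module A M := Module.compHom M σ
  let _ : Module A N := Module.compHom N σ
  let f' : M →ₗ[A] N := { f with map_smul' := fun a => f.map_smul (σ a) }
  let g' : P →ₗ[A] N := { g with map_smul' := g.map_smulₛₗ }
  obtain ⟨h, hh⟩ := Module.projective_lifting_property f' g' hf
  exact ⟨{ h with map_smul' := h.map_smul }, LinearMap.congr_fun hh⟩

variable {A A' : Type*} [Ring A] [Ring A'] {P P' M M' : Type*} [AddCommGroup P] [Module A P]
  [AddCommGroup P'] [Module A' P'] [AddCommGroup M] [Module A M] [AddCommGroup M'] [Module A' M']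

theorem IsProjectiveCover.surjective_of_comp_eq {π : P →ₗ[A] M} (hπ : IsProjectiveCover π)
    {f : P →ₗ[A] P} (hf : ∀ p, π (f p) = π p) : Function.Surjective f := by
  refine LinearMap.range_eq_top.1 (hπ.essential _ (eq_top_iff.2 fun p _ => ?_))
  refine Submodule.mem_sup.2 ⟨f p, ⟨p, rfl⟩, p - f p, ?_, add_sub_cancel _ _⟩
  rw [LinearMap.mem_ker, map_sub, hf, sub_self]

theorem IsProjectiveCover.bijective_of_comp_eq {π : P →ₗ[A] M} (hπ : IsProjectiveCover π)
    {f : P →ₗ[A] P} (hf : ∀ p, π (f p) = π p) : Function.Bijective f := by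
  have := hπ.projective
  have f_surj := hπ.surjective_of_comp_eq hf
  obtain ⟨s, hs⟩ := projective_semilinear_lifting_property f LinearMap.id f_surj
  have s_surj := hπ.surjective_of_comp_eq (f := s) fun p => by rw [← hf, hs, LinearMap.id_apply]
  exact ⟨(Function.LeftInverse.rightInverse_of_surjective hs s_surj).injective, f_surj⟩

variable {σ : A →+* A'} {σ' : A' →+* A} [RingHomInvPair σ σ'] [RingHomInvPair σ' σ]
  {π : P →ₗ[A] M} {π' : P' →ₗ[A'] M'}

theorem IsProjectiveCover.exists_equiv (hπ : IsProjectiveCover π) (hπ' : IsProjectiveCover π')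
    (h : M ≃ₛₗ[σ] M') : ∃ e : P ≃ₛₗ[σ] P', ∀ p, π' (e p) = h (π p) := by
  have := hπ.projective
  have := hπ'.projective
  obtain ⟨f, hf⟩ := projective_semilinear_lifting_property π' (h.toLinearMap.comp π) hπ'.surjective
  obtain ⟨g, hg⟩ :=
    projective_semilinear_lifting_property π (h.symm.toLinearMap.comp π') hπ.surjective
  have gf_bij : Function.Bijective (g.comp f) := hπ.bijective_of_comp_eq fun p => by simp [hf, hg]
  have fg_bij : Function.Bijective (f.comp g) := hπ'.bijective_of_comp_eq fun p => by simp [hf, hg]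
  have f_bij : Function.Bijective f :=
    ⟨.of_comp (f := g) gf_bij.injective, .of_comp (g := g) fg_bij.surjective⟩
  exact ⟨LinearEquiv.ofBijective f f_bij, hf⟩

/-- The isomorphism of kernels induced by an isomorphism of homomorphisms `π ≅ π'`. -/
def kerEquiv (e : P ≃ₛₗ[σ] P') (h : M ≃ₛₗ[σ] M') (he : ∀ p, π' (e p) = h (π p)) :
    LinearMap.ker π ≃ₛₗ[σ] LinearMap.ker π' :=
  e.ofSubmodules _ _ <| by
    ext y
    obtain ⟨p, rfl⟩ := e.surjective y
    rw [LinearMap.mem_ker, he, h.map_eq_zero_iff]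
    simp

end ProjectiveCoverUniqueness

section BaseChange

variable {A B : Type*} [Ring A] [Ring B] {φ : A →+* B} {M : Type*} [AddCommGroup M] [Module A M]

namespace BaseChange

variable (φ M) in
/-- The canonical map `m ↦ 1 ⊗ m` from `M` to `B ⊗_A M`. -/
def unit : M →ₛₗ[φ] BaseChange φ M where
  toFun m := (balancingSubmodule φ M).mkQ (1 ⊗ₜ m)
  map_add' m m' := by rw [TensorProduct.tmul_add, map_add]
  map_smul' a m := by
    have balanced : (1 * φ a) ⊗ₜ[ℤ] m - 1 ⊗ₜ (a • m) ∈ balancingSubmodule φ M :=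
      Submodule.subset_span ⟨1, a, m, rfl⟩
    rw [← map_smul, TensorProduct.smul_tmul', smul_eq_mul, mul_one, eq_comm, ← sub_eq_zero,
      ← map_sub, Submodule.mkQ_apply, Submodule.Quotient.mk_eq_zero]
    rwa [one_mul] at balanced

theorem smul_unit (b : B) (m : M) :
    b • unit φ M m = (balancingSubmodule φ M).mkQ (b ⊗ₜ m) := by
  change b • (balancingSubmodule φ M).mkQ (1 ⊗ₜ m) = _
  rw [← map_smul, TensorProduct.smul_tmul', smul_eq_mul, mul_one]

@[elab_as_elim]
theorem induction_on {p : BaseChange φ M → Prop} (y : BaseChange φ M) (zero : p 0)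
    (smul_unit : ∀ (b : B) (m : M), p (b • unit φ M m))
    (add : ∀ x y, p x → p y → p (x + y)) : p y := by
  obtain ⟨t, rfl⟩ := Submodule.mkQ_surjective _ y
  induction t with
  | zero => rwa [map_zero]
  | add x y hx hy => rw [map_add]; exact add _ _ hx hy
  | tmul b m => exact (BaseChange.smul_unit (φ := φ) b m).symm ▸ smul_unit b m

variable {X : Type*} [AddCommGroup X] {f : B →+ M →+ X}

theorem lift_eq_zero_of_mem_balancingSubmodule (hf : ∀ b a m, f (b * φ a) m = f b (a • m))
    (hf' : ∀ (r : ℤ) b m, f (r • b) m = f b (r • m)) {t : B ⊗[ℤ] M}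
    (ht : t ∈ balancingSubmodule φ M) : TensorProduct.liftAddHom f hf' t = 0 := by
  suffices ∀ c : B, TensorProduct.liftAddHom f hf' (c • t) = 0 by simpa only [one_smul] using this 1
  rw [balancingSubmodule] at ht
  induction ht using Submodule.span_induction with
  | zero => exact fun c => by rw [smul_zero, map_zero]
  | add x y _ _ hx hy => exact fun c => by rw [smul_add, map_add, hx, hy, add_zero]
  | smul d x _ hx => exact fun c => by rw [← mul_smul, hx]
  | mem x hx =>
    obtain ⟨b, a, m, rfl⟩ := hx
    intro c
    rw [smul_sub, TensorProduct.smul_tmul', TensorProduct.smul_tmul', map_sub,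
      TensorProduct.liftAddHom_tmul, TensorProduct.liftAddHom_tmul, smul_eq_mul, smul_eq_mul,
      ← mul_assoc, hf, sub_self]

variable (f) in
/-- The additive map `b ⊗ m ↦ f b m` out of `B ⊗_A M` for a balanced biadditive map `f`. -/
def liftAddHom (hf : ∀ b a m, f (b * φ a) m = f b (a • m)) : BaseChange φ M →+ X :=
  QuotientAddGroup.lift (balancingSubmodule φ M).toAddSubgroup
    (TensorProduct.liftAddHom f fun r b m => by
      rw [map_zsmul, map_zsmul, AddMonoidHom.zsmul_apply])
    fun _ ht => lift_eq_zero_of_mem_balancingSubmodule hf _ ht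

theorem liftAddHom_smul_unit (hf : ∀ b a m, f (b * φ a) m = f b (a • m)) (b : B) (m : M) :
    liftAddHom f hf (b • unit φ M m) = f b m := by
  rw [smul_unit]
  rfl

end BaseChange

end BaseChange

section KDual

namespace KDual

variable {k : Type*} [Field k] {X Y : Type*} [AddCommGroup X] [Module k X] [AddCommGroup Y]
  [Module k Y]

variable (k X) in
/-- The evaluation pairing of a module with its `k`-dual. -/
def pairing : X →+ KDual k X →+ k :=
  .mk' (fun x => .mk' (fun ξ : X →ₗ[k] k => ξ x) fun _ _ => rfl) fun x y =>
    AddMonoidHom.ext fun ξ : X →ₗ[k] k => map_add ξ x y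

theorem ext {ξ η : KDual k X} (h : ∀ x, pairing k X x ξ = pairing k X x η) : ξ = η :=
  LinearMap.ext h

/-- The transpose of a `k`-linear map. -/
def map (f : X →ₗ[k] Y) : KDual k Y →+ KDual k X :=
  .mk' (fun η : Y →ₗ[k] k => η.comp f) fun _ _ => rfl

end KDual

end KDual

/-- A Frobenius system for a ring homomorphism `φ : A → B`: a homomorphism of `A`-bimodules
`E : B → A` with dual bases `x` and `y`. Its existence says that `B` is a Frobenius extension
of `A`. -/
structure FrobeniusSystem {A B : Type*} [Ring A] [Ring B] (φ : A →+* B) (ι : Type*)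
    [Fintype ι] where
  /-- The Frobenius homomorphism. -/
  E : B →+ A
  E_map_mul : ∀ a b, E (φ a * b) = a * E b
  E_mul_map : ∀ b a, E (b * φ a) = E b * a
  /-- The basis of `B` as a right `A`-module. -/
  x : ι → B
  /-- The dual basis, of `B` as a left `A`-module. -/
  y : ι → B
  sum_x_mul : ∀ b, ∑ i, x i * φ (E (y i * b)) = b
  sum_mul_y : ∀ b, ∑ i, φ (E (b * x i)) * y i = b

namespace FrobeniusSystem

variable {A B : Type*} [Ring A] [Ring B] {φ : A →+* B} {ι : Type*} [Fintype ι]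

/-- A Frobenius system whose right basis normalizes `A`: each left multiplication `b ↦ x i * b`
intertwines the left actions of `A` up to an automorphism of `A`. -/
def IsNormal (F : FrobeniusSystem φ ι) : Prop :=
  ∀ i, ∃ σ : A ≃+* A, ∀ a, F.x i * φ a = φ (σ a) * F.x i

/-- The Frobenius system of the opposite rings, in which the two bases change roles. -/
def op (F : FrobeniusSystem φ ι) : FrobeniusSystem (RingHom.op φ) ι where
  E := AddMonoidHom.mulOp F.E
  E_map_mul a b := MulOpposite.unop_injective (F.E_mul_map b.unop a.unop)
  E_mul_map b a := MulOpposite.unop_injective (F.E_map_mul a.unop b.unop)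
  x i := .op (F.y i)
  y i := .op (F.x i)
  sum_x_mul b := MulOpposite.unop_injective <| by
    rw [Finset.unop_sum]
    exact F.sum_mul_y b.unop
  sum_mul_y b := MulOpposite.unop_injective <| by
    rw [Finset.unop_sum]
    exact F.sum_x_mul b.unop

/-- Maps that exhibit the `B`-module `N` as `B ⊗_A M`: under the identification `unit m = 1 ⊗ m` and
`trace (b ⊗ m) = E b • m`. Both maps refer only to elements, so that they can be transported along
constructions on `M` and `N` without choosing an isomorphism. -/
structure Induction (F : FrobeniusSystem φ ι) (M N : Type*) [AddCommGroup M] [Module A M]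
    [AddCommGroup N] [Module B N] where
  /-- The map `m ↦ 1 ⊗ m`. -/
  unit : M →ₛₗ[φ] N
  /-- The map `b ⊗ m ↦ E b • m`. -/
  trace : N →+ M
  trace_smul_unit : ∀ b m, trace (b • unit m) = F.E b • m
  sum_smul_unit : ∀ n, ∑ i, F.x i • unit (trace (F.y i • n)) = n

variable (F : FrobeniusSystem φ ι) {M M' N N' : Type*} [AddCommGroup M] [Module A M]
  [AddCommGroup M'] [Module A M'] [AddCommGroup N] [Module B N] [AddCommGroup N'] [Module B N']

variable (M) in
/-- The additive map `b ⊗ m ↦ E b • m`. -/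
def baseChangeTrace : BaseChange φ M →+ M :=
  BaseChange.liftAddHom ((smulAddHom A M).comp F.E) fun b a m => by
    rw [AddMonoidHom.comp_apply, AddMonoidHom.comp_apply, smulAddHom_apply, smulAddHom_apply,
      F.E_mul_map, mul_smul]

theorem baseChangeTrace_smul_unit (b : B) (m : M) :
    F.baseChangeTrace M (b • BaseChange.unit φ M m) = F.E b • m :=
  BaseChange.liftAddHom_smul_unit _ b m

variable (M) in
/-- The base change `B ⊗_A M` is induced from `M`. -/
def baseChange : F.Induction M (BaseChange φ M) where
  unit := BaseChange.unit φ M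
  trace := F.baseChangeTrace M
  trace_smul_unit := F.baseChangeTrace_smul_unit
  sum_smul_unit n := by
    induction n using BaseChange.induction_on with
    | zero => simp only [smul_zero, map_zero, Finset.sum_const_zero]
    | add n n' hn hn' => simp only [smul_add, map_add, Finset.sum_add_distrib, hn, hn']
    | smul_unit b m =>
      simp only [← mul_smul, F.baseChangeTrace_smul_unit, map_smulₛₗ, ← Finset.sum_smul,
        F.sum_x_mul]

namespace Induction

variable {F}

@[elab_as_elim]
theorem induction_on (I : F.Induction M N) {p : N → Prop} (n : N) (zero : p 0)
    (smul_unit : ∀ (b : B) (m : M), p (b • I.unit m))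
    (add : ∀ n n', p n → p n' → p (n + n')) : p n := by
  rw [← I.sum_smul_unit n]
  exact Finset.sum_induction _ p add zero fun i _ => smul_unit _ _

theorem hom_ext (I : F.Induction M N) {f g : N →ₗ[B] N'} (h : ∀ m, f (I.unit m) = g (I.unit m)) :
    f = g := by
  ext n
  induction n using I.induction_on with
  | zero => rw [map_zero, map_zero]
  | smul_unit b m => rw [map_smul, map_smul, h]
  | add n n' hn hn' => rw [map_add, map_add, hn, hn']

theorem trace_map_smul (I : F.Induction M N) (a : A) (n : N) :
    I.trace (φ a • n) = a • I.trace n := by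
  induction n using I.induction_on with
  | zero => simp only [smul_zero, map_zero]
  | smul_unit b m => rw [← mul_smul, I.trace_smul_unit, I.trace_smul_unit, F.E_map_mul, mul_smul]
  | add n n' hn hn' => rw [smul_add, map_add, map_add, hn, hn', smul_add]

theorem trace_apply_of_unit_apply (I : F.Induction M N) (I' : F.Induction M' N') {f : M →ₗ[A] M'}
    {g : N →ₗ[B] N'} (h : ∀ m, g (I.unit m) = I'.unit (f m)) (n : N) :
    I'.trace (g n) = f (I.trace n) := by
  induction n using I.induction_on with
  | zero => simp only [map_zero]
  | smul_unit b m => rw [map_smul, h, I'.trace_smul_unit, I.trace_smul_unit, map_smul]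
  | add n n' hn hn' => rw [map_add, map_add, map_add, map_add, hn, hn']

theorem sum_smul_apply_trace_smul_unit (I : F.Induction M N) (f : M →ₛₗ[φ] N') (b : B) (m : M) :
    ∑ i, F.x i • f (I.trace (F.y i • b • I.unit m)) = b • f m := by
  simp only [← mul_smul, I.trace_smul_unit, map_smulₛₗ, ← Finset.sum_smul, F.sum_x_mul]

/-- The `B`-linear map `B ⊗_A M → N'`, `b ⊗ m ↦ b • f m`. -/
def extend (I : F.Induction M N) (f : M →ₛₗ[φ] N') : N →ₗ[B] N' where
  toFun n := ∑ i, F.x i • f (I.trace (F.y i • n))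
  map_add' n n' := by simp only [smul_add, map_add, Finset.sum_add_distrib]
  map_smul' b n := by
    induction n using I.induction_on with
    | zero => simp only [smul_zero, map_zero, Finset.sum_const_zero]
    | smul_unit c m =>
      rw [← mul_smul, sum_smul_apply_trace_smul_unit, sum_smul_apply_trace_smul_unit, mul_smul,
        RingHom.id_apply]
    | add n n' hn hn' =>
      simp only [smul_add, map_add, Finset.sum_add_distrib] at hn hn' ⊢
      rw [hn, hn']

@[simp]
theorem extend_unit (I : F.Induction M N) (f : M →ₛₗ[φ] N') (m : M) :
    I.extend f (I.unit m) = f m := by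
  rw [← one_smul B (I.unit m), ← one_smul B (f m)]
  exact I.sum_smul_apply_trace_smul_unit f 1 m

/-- The isomorphism between two modules induced from `M`. -/
def equiv (I : F.Induction M N) (I' : F.Induction M N') : N ≃ₗ[B] N' :=
  LinearEquiv.ofLinearMap (I.extend I'.unit) (I'.extend I.unit)
    (I'.hom_ext fun m => by simp) (I.hom_ext fun m => by simp)

/-- Transport along an isomorphism of the induced module. -/
def congr (I : F.Induction M N) (e : N ≃ₗ[B] N') : F.Induction M N' where
  unit := e.toLinearMap.comp I.unit
  trace := I.trace.comp e.symm.toLinearMap.toAddMonoidHom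
  trace_smul_unit b m := by simp [I.trace_smul_unit]
  sum_smul_unit n := e.symm.injective <| by simp [map_sum, I.sum_smul_unit]

/-- Induction is compatible with kernels. -/
def ker (I : F.Induction M N) (I' : F.Induction M' N') {f : M →ₗ[A] M'} {g : N →ₗ[B] N'}
    (h : ∀ m, g (I.unit m) = I'.unit (f m)) :
    F.Induction (LinearMap.ker f) (LinearMap.ker g) where
  unit := (I.unit.comp (LinearMap.ker f).subtype).codRestrict (LinearMap.ker g) fun m => by
    simp [h]
  trace := (I.trace.comp (LinearMap.ker g).subtype.toAddMonoidHom).codRestrict (LinearMap.ker f)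
    fun n => by
      rw [LinearMap.mem_ker]
      simp [← I.trace_apply_of_unit_apply I' h]
  trace_smul_unit b m := Subtype.ext (I.trace_smul_unit b m)
  sum_smul_unit n := Subtype.ext <| by
    rw [AddSubmonoidClass.coe_finsetSum]
    exact I.sum_smul_unit n

/-- Induction is compatible with cokernels. -/
def coker (I : F.Induction M N) (I' : F.Induction M' N') {f : M →ₗ[A] M'} {g : N →ₗ[B] N'}
    (h : ∀ m, g (I.unit m) = I'.unit (f m)) :
    F.Induction (M' ⧸ LinearMap.range f) (N' ⧸ LinearMap.range g) where
  unit := (LinearMap.range f).mapQ (LinearMap.range g) I'.unit <| by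
    rintro _ ⟨m, rfl⟩
    exact ⟨I.unit m, h m⟩
  trace := QuotientAddGroup.map (LinearMap.range g).toAddSubgroup
    (LinearMap.range f).toAddSubgroup I'.trace <| by
      rintro _ ⟨n, rfl⟩
      exact ⟨I.trace n, (I.trace_apply_of_unit_apply I' h n).symm⟩
  trace_smul_unit b := (LinearMap.range f).mkQ_surjective.forall.2 fun m =>
    congrArg (LinearMap.range f).mkQ (I'.trace_smul_unit b m)
  sum_smul_unit := (LinearMap.range g).mkQ_surjective.forall.2 fun n => by
    conv_rhs => rw [← I'.sum_smul_unit n, map_sum]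
    rfl

/-- Induction of right modules is compatible with the duality `Hom(-, A)`. -/
def homRegular (I : F.Induction M N) : F.op.Induction (M →ₗ[A] A) (N →ₗ[B] B) where
  unit :=
    { toFun f := I.extend (φ.toSemilinearMap.comp f)
      map_add' f f' := I.hom_ext fun m => by simp
      map_smul' a f := I.hom_ext fun m => by simp }
  trace :=
    { toFun g :=
        { toFun m := F.E (g (I.unit m))
          map_add' m m' := by simp
          map_smul' a m := by simp [F.E_map_mul] }
      map_zero' := by ext; simp
      map_add' g g' := by ext; simp }
  trace_smul_unit b f := by
    ext m
    exact (congrArg F.E (by simp)).trans (F.E_map_mul (f m) b.unop)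
  sum_smul_unit g := I.hom_ext fun m => by
    simp [op, F.sum_mul_y]

theorem homRegularMap_homRegular_unit
    (I : F.Induction M N) (I' : F.Induction M' N') {f : M →ₗ[A] M'} {g : N →ₗ[B] N'}
    (h : ∀ m, g (I.unit m) = I'.unit (f m)) (ξ : M' →ₗ[A] A) :
    homRegularMap B g (I'.homRegular.unit ξ) = I.homRegular.unit (homRegularMap A f ξ) :=
  I.hom_ext fun m => by simp [homRegularMap, homRegular, h]

section Dual

section Scalars

variable {k : Type*} [CommRing k] [Algebra k A] [Algebra k B] [Module k M] [Module k N]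
  [IsScalarTower k A M] [IsScalarTower k B N]

theorem unit_smul (hφ : ∀ c, φ (algebraMap k A c) = algebraMap k B c)
    (I : F.Induction M N) (c : k) (m : M) :
    I.unit (c • m) = c • I.unit m := by
  rw [← algebraMap_smul A c m, map_smulₛₗ, hφ, algebraMap_smul]

theorem trace_smul (hφ : ∀ c, φ (algebraMap k A c) = algebraMap k B c)
    (I : F.Induction M N) (c : k) (n : N) :
    I.trace (c • n) = c • I.trace n := by
  rw [← algebraMap_smul B c n, ← hφ, I.trace_map_smul, algebraMap_smul]

end Scalars

variable {k : Type*} [Field k] [Algebra k A] [Algebra k B]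
  {X Y : Type*} [AddCommGroup X] [Module k X] [Module Aᵐᵒᵖ X] [IsScalarTower k Aᵐᵒᵖ X]
  [AddCommGroup Y] [Module k Y] [Module Bᵐᵒᵖ Y] [IsScalarTower k Bᵐᵒᵖ Y]

/-- Induction is compatible with the `k`-duality between right and left modules, under which the
unit and the trace change roles. -/
def kDual (hφ : ∀ c, φ (algebraMap k A c) = algebraMap k B c) (I : F.op.Induction X Y) :
    F.Induction (KDual k X) (KDual k Y) :=
  have hφ_op (c : k) : RingHom.op φ (algebraMap k Aᵐᵒᵖ c) = algebraMap k Bᵐᵒᵖ c :=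
    congrArg MulOpposite.op (hφ c)
  let unit : X →ₗ[k] Y := { I.unit with map_smul' := I.unit_smul hφ_op }
  let trace : Y →ₗ[k] X := { I.trace with map_smul' := I.trace_smul hφ_op }
  { unit :=
      { KDual.map trace with
        map_smul' := fun a ξ => KDual.ext fun y =>
          congrArg (KDual.pairing k X · ξ) (I.trace_map_smul (.op a) y).symm }
    trace := KDual.map unit
    trace_smul_unit := fun b ξ => KDual.ext fun x =>
      congrArg (KDual.pairing k X · ξ) (I.trace_smul_unit (.op b) x)
    sum_smul_unit := fun η => KDual.ext fun y => by
      conv_rhs => rw [← I.sum_smul_unit y, map_sum, AddMonoidHom.finsetSum_apply]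
      rw [map_sum]
      rfl }

end Dual

section ProjectiveCover

theorem projective (I : F.Induction M N) [Module.Projective A M] : Module.Projective B N := by
  refine .of_lifting_property'' fun f hf => ?_
  obtain ⟨h, hh⟩ := projective_semilinear_lifting_property f I.unit hf
  exact ⟨I.extend h, I.hom_ext fun m => by simp [hh]⟩

theorem surjective (I : F.Induction M N) (I' : F.Induction M' N') {f : M →ₗ[A] M'} {g : N →ₗ[B] N'}
    (h : ∀ m, g (I.unit m) = I'.unit (f m)) (hf : Function.Surjective f) :
    Function.Surjective g := by
  intro n
  induction n using I'.induction_on with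
  | zero => exact ⟨0, map_zero g⟩
  | smul_unit b m =>
    obtain ⟨m, rfl⟩ := hf m
    exact ⟨b • I.unit m, by rw [map_smul, h]⟩
  | add n n' hn hn' =>
    obtain ⟨⟨l, rfl⟩, ⟨l', rfl⟩⟩ := hn, hn'
    exact ⟨l + l', map_add g l l'⟩

theorem isSuperfluous_ker (hF : F.IsNormal) (I : F.Induction M N) (I' : F.Induction M' N')
    {f : M →ₗ[A] M'} {g : N →ₗ[B] N'} (h : ∀ m, g (I.unit m) = I'.unit (f m))
    (hf : IsSuperfluous (LinearMap.ker f)) : IsSuperfluous (LinearMap.ker g) := by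
  choose σ hσ using hF
  have (i : ι) : RingHomSurjective (σ i : A →+* A) := ⟨(σ i).surjective⟩
  let _ : Module A N := Module.compHom N φ
  let smulUnit (i : ι) : M →ₛₗ[(σ i : A →+* A)] N :=
    { toFun m := F.x i • I.unit m
      map_add' m m' := by rw [map_add, smul_add]
      map_smul' a m := by
        rw [map_smulₛₗ, ← mul_smul, hσ, mul_smul]
        rfl }
  let restrict : N →ₛₗ[φ] N := { AddMonoidHom.id N with map_smul' := fun _ _ => rfl }
  have mem_sup (n : N) (hn : g n = 0) :
      n ∈ Finset.univ.sup fun i => (LinearMap.ker f).map (smulUnit i) := by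
    rw [← I.sum_smul_unit n]
    refine Submodule.sum_mem _ fun i hi => ?_
    refine Finset.le_sup (f := fun i => (LinearMap.ker f).map (smulUnit i)) hi
      ⟨I.trace (F.y i • n), ?_, rfl⟩
    change f (I.trace (F.y i • n)) = 0
    rw [← I.trace_apply_of_unit_apply I' h, map_smul, hn, smul_zero, map_zero]
  intro L hL
  have comap_eq_top : L.comap restrict = ⊤ := by
    refine IsSuperfluous.finset_sup .univ (fun i => hf.map (smulUnit i)) _ (eq_top_iff.2 ?_)
    intro n _
    obtain ⟨l, hl, z, hz, rfl⟩ := Submodule.mem_sup.1 (hL ▸ Submodule.mem_top : n ∈ L ⊔ _)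
    exact Submodule.add_mem_sup hl (mem_sup z hz)
  exact eq_top_iff.2 fun n _ => (comap_eq_top ▸ Submodule.mem_top : n ∈ L.comap restrict)

theorem isProjectiveCover (hF : F.IsNormal) (I : F.Induction M N) (I' : F.Induction M' N')
    {π : M →ₗ[A] M'} {π' : N →ₗ[B] N'} (h : ∀ m, π' (I.unit m) = I'.unit (π m))
    (hπ : IsProjectiveCover π) : IsProjectiveCover π' :=
  have := hπ.projective
  ⟨I.projective, I.surjective I' h hπ.surjective, I.isSuperfluous_ker hF I' h hπ.essential⟩

end ProjectiveCover

section ARTranslate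

variable [IsArtinianRing A] [IsArtinianRing B] [Module.Finite A M] [Module.Finite B N]

theorem exists_projCover (hF : F.IsNormal) (I : F.Induction M N) :
    ∃ J : F.Induction (ProjCover A M) (ProjCover B N),
      ∀ p, projCoverMap B N (J.unit p) = I.unit (projCoverMap A M p) := by
  let J := F.baseChange (ProjCover A M)
  let π := J.extend (I.unit.comp (projCoverMap A M))
  have unit_comm (p) : π (J.unit p) = I.unit (projCoverMap A M p) := J.extend_unit _ p
  have hπ : IsProjectiveCover π :=
    J.isProjectiveCover hF I unit_comm (isProjectiveCover_projCoverMap A M)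
  obtain ⟨e, he⟩ := hπ.exists_equiv (isProjectiveCover_projCoverMap B N) (.refl B N)
  exact ⟨J.congr e, fun p => (he _).trans (unit_comm p)⟩

theorem nonempty_syzygy (hF : F.IsNormal) (I : F.Induction M N) :
    Nonempty (F.Induction (Syzygy A M) (Syzygy B N)) :=
  let ⟨J, hJ⟩ := I.exists_projCover hF
  ⟨J.ker I hJ⟩

theorem nonempty_arTranslate {k : Type*} [Field k] [Algebra k A] [Algebra k B]
    (hφ : ∀ c, φ (algebraMap k A c) = algebraMap k B c) (hF : F.IsNormal) (I : F.Induction M N) :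
    Nonempty (F.Induction (ARTranslate A M k) (ARTranslate B N k)) := by
  obtain ⟨J₀, hJ₀⟩ := I.exists_projCover hF
  obtain ⟨J₁, hJ₁⟩ := (J₀.ker I hJ₀).exists_projCover hF
  have minPresMap_unit (p) : minPresMap B N (J₁.unit p) = J₀.unit (minPresMap A M p) :=
    congrArg Subtype.val (hJ₁ p)
  exact ⟨(J₀.homRegular.coker J₁.homRegular
    (J₁.homRegularMap_homRegular_unit J₀ minPresMap_unit)).kDual hφ⟩

end ARTranslate

end Induction

end FrobeniusSystem

section GroupAlgebra

open MonoidAlgebra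

variable (k : Type*) [Ring k] {Gt : Type*} [Group Gt] (G : Subgroup Gt)

/-- The automorphism of `k[G]` given by conjugation with an element of an overgroup that contains
`G` as a normal subgroup. -/
def conjRingEquiv [G.Normal] (x : Gt) : MonoidAlgebra k G ≃+* MonoidAlgebra k G :=
  mapDomainRingEquiv k (MulAut.conjNormal x)

theorem mapDomainRingHom_subtype_conjRingEquiv_mul_single [G.Normal] (x : Gt)
    (a : MonoidAlgebra k G) :
    mapDomainRingHom k G.subtype (conjRingEquiv k G x a) * single x 1 =
      single x 1 * mapDomainRingHom k G.subtype a := by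
  induction a using MonoidAlgebra.induction_linear with
  | zero => simp only [map_zero, zero_mul, mul_zero]
  | add a b ha hb => simp only [map_add, mul_add, add_mul, ha, hb]
  | single h c => simp [conjRingEquiv]

/-- The projection `k[Gt] → k[G]` that restricts the coefficients to `G`. -/
def restrictCoeff : MonoidAlgebra k Gt →+ MonoidAlgebra k G :=
  comapDomainAddMonoidHom G.subtype G.subtype_injective

variable {k} {G}

theorem restrictCoeff_single_of_mem {g : Gt} (hg : g ∈ G) (c : k) :
    restrictCoeff k G (single g c) = single ⟨g, hg⟩ c :=
  comapDomain_single_map G.subtype G.subtype_injective ⟨g, hg⟩ c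

theorem restrictCoeff_single_of_notMem {g : Gt} (hg : g ∉ G) (c : k) :
    restrictCoeff k G (single g c) = 0 :=
  comapDomain_single_of_not_mem_range (by rintro ⟨h, rfl⟩; exact hg h.2) G.subtype_injective

theorem restrictCoeff_map_mul (a : MonoidAlgebra k G) (b : MonoidAlgebra k Gt) :
    restrictCoeff k G (mapDomainRingHom k G.subtype a * b) = a * restrictCoeff k G b := by
  induction a using MonoidAlgebra.induction_linear with
  | zero => simp only [map_zero, zero_mul]
  | add a a' ha ha' => simp only [map_add, add_mul, ha, ha']
  | single h c =>
    induction b using MonoidAlgebra.induction_linear with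
    | zero => simp only [map_zero, mul_zero]
    | add b b' hb hb' => simp only [map_add, mul_add, hb, hb']
    | single g d =>
      rw [mapDomainRingHom_apply, mapDomain_single, Subgroup.subtype_apply, single_mul_single]
      by_cases hg : g ∈ G
      · rw [restrictCoeff_single_of_mem hg, restrictCoeff_single_of_mem (G.mul_mem h.2 hg),
          single_mul_single]
        rfl
      · rw [restrictCoeff_single_of_notMem hg, mul_zero, restrictCoeff_single_of_notMem]
        rwa [G.mul_mem_cancel_left h.2]

theorem restrictCoeff_mul_map (b : MonoidAlgebra k Gt) (a : MonoidAlgebra k G) :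
    restrictCoeff k G (b * mapDomainRingHom k G.subtype a) = restrictCoeff k G b * a := by
  induction a using MonoidAlgebra.induction_linear with
  | zero => simp only [map_zero, mul_zero]
  | add a a' ha ha' => simp only [map_add, mul_add, ha, ha']
  | single h c =>
    induction b using MonoidAlgebra.induction_linear with
    | zero => simp only [map_zero, zero_mul]
    | add b b' hb hb' => simp only [map_add, add_mul, hb, hb']
    | single g d =>
      rw [mapDomainRingHom_apply, mapDomain_single, Subgroup.subtype_apply, single_mul_single]
      by_cases hg : g ∈ G
      · rw [restrictCoeff_single_of_mem hg, restrictCoeff_single_of_mem (G.mul_mem hg h.2),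
          single_mul_single]
        rfl
      · rw [restrictCoeff_single_of_notMem hg, zero_mul, restrictCoeff_single_of_notMem]
        rwa [G.mul_mem_cancel_right h.2]

open Classical in
theorem mapDomainRingHom_restrictCoeff_single (g : Gt) (c : k) :
    mapDomainRingHom k G.subtype (restrictCoeff k G (single g c)) =
      if g ∈ G then single g c else 0 := by
  split_ifs with hg
  · rw [restrictCoeff_single_of_mem hg, mapDomainRingHom_apply, mapDomain_single]
    rfl
  · rw [restrictCoeff_single_of_notMem hg, map_zero]

variable [Fintype (Gt ⧸ G)]

theorem sum_single_out_mul_restrictCoeff (b : MonoidAlgebra k Gt) :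
    ∑ q : Gt ⧸ G, single q.out 1 *
      mapDomainRingHom k G.subtype (restrictCoeff k G (single q.out⁻¹ 1 * b)) = b := by
  classical
  induction b using MonoidAlgebra.induction_linear with
  | zero => simp only [mul_zero, map_zero, Finset.sum_const_zero]
  | add b b' hb hb' => simp only [mul_add, map_add, Finset.sum_add_distrib, hb, hb']
  | single g c =>
    have mem_iff (q : Gt ⧸ G) : q.out⁻¹ * g ∈ G ↔ q = (g : Gt) := by
      rw [← QuotientGroup.eq, QuotientGroup.out_eq']
    simp only [single_mul_single, mapDomainRingHom_restrictCoeff_single, mem_iff]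
    simp

theorem sum_restrictCoeff_mul_single_out (b : MonoidAlgebra k Gt) :
    ∑ q : Gt ⧸ G, mapDomainRingHom k G.subtype (restrictCoeff k G (b * single q.out 1)) *
      single q.out⁻¹ 1 = b := by
  classical
  induction b using MonoidAlgebra.induction_linear with
  | zero => simp only [zero_mul, map_zero, Finset.sum_const_zero]
  | add b b' hb hb' => simp only [add_mul, map_add, Finset.sum_add_distrib, hb, hb']
  | single g c =>
    have mem_iff (q : Gt ⧸ G) : g * q.out ∈ G ↔ q = (g⁻¹ : Gt) := by
      rw [eq_comm, ← QuotientGroup.out_eq' q, QuotientGroup.eq, QuotientGroup.out_eq', inv_inv]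
    simp only [single_mul_single, mapDomainRingHom_restrictCoeff_single, mem_iff]
    simp

variable (k G)

/-- The Frobenius system of a group algebra over the group algebra of a subgroup of finite index,
given by the coset representatives `q.out` and their inverses. -/
def groupAlgebraFrobeniusSystem :
    FrobeniusSystem (mapDomainRingHom k G.subtype) (Gt ⧸ G) where
  E := restrictCoeff k G
  E_map_mul := restrictCoeff_map_mul
  E_mul_map := restrictCoeff_mul_map
  x q := single q.out 1
  y q := single q.out⁻¹ 1
  sum_x_mul := sum_single_out_mul_restrictCoeff
  sum_mul_y := sum_restrictCoeff_mul_single_out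

theorem groupAlgebraFrobeniusSystem_isNormal [G.Normal] :
    (groupAlgebraFrobeniusSystem k G).IsNormal := fun q =>
  ⟨conjRingEquiv k G q.out,
    fun a => (mapDomainRingHom_subtype_conjRingEquiv_mul_single k G q.out a).symm⟩

end GroupAlgebra

section Conjugate

variable {k : Type*} [Field k] {Gt : Type*} [Group Gt] {G : Subgroup Gt} [G.Normal]

instance (x : Gt) : RingHomInvPair (conjRingEquiv k G x : MonoidAlgebra k G →+* MonoidAlgebra k G)
    (conjRingEquiv k G x).symm :=
  .of_ringEquiv _

instance (x : Gt) : RingHomInvPair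
    ((conjRingEquiv k G x).symm : MonoidAlgebra k G →+* MonoidAlgebra k G) (conjRingEquiv k G x) :=
  .of_ringEquiv (conjRingEquiv k G x).symm

/-- The identity map as a semilinear equivalence from a module to its conjugate. -/
def conjModEquiv (x : Gt) (M : Type*) [AddCommGroup M] [Module (MonoidAlgebra k G) M] :
    M ≃ₛₗ[(conjRingEquiv k G x : MonoidAlgebra k G →+* MonoidAlgebra k G)] ConjMod x M :=
  { AddEquiv.refl M with
    map_smul' := fun a m => by
      have conj_inv_conj : MonoidAlgebra.mapDomainRingHom k
          ((MulAut.conjNormal x⁻¹ : MulAut G) : G →* G) (conjRingEquiv k G x a) = a := by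
        rw [map_inv]
        exact (conjRingEquiv k G x).symm_apply_apply a
      exact congrArg (· • m) conj_inv_conj.symm }

variable (k G) in
theorem nonempty_conjMod_projCover_and_syzygy [Finite G] (M : Type*) [AddCommGroup M]
    [Module (MonoidAlgebra k G) M] [Module.Finite (MonoidAlgebra k G) M] (x : Gt)
    (h : ConjMod x M ≃ₗ[MonoidAlgebra k G] M) :
    Nonempty (ConjMod x (ProjCover (MonoidAlgebra k G) M) ≃ₗ[MonoidAlgebra k G]
      ProjCover (MonoidAlgebra k G) M) ∧
    Nonempty (ConjMod x (Syzygy (MonoidAlgebra k G) M) ≃ₗ[MonoidAlgebra k G]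
      Syzygy (MonoidAlgebra k G) M) := by
  have hπ := isProjectiveCover_projCoverMap (MonoidAlgebra k G) M
  obtain ⟨e, he⟩ := hπ.exists_equiv hπ ((conjModEquiv x M).trans h)
  exact ⟨⟨(conjModEquiv x _).symm.trans e⟩, ⟨(conjModEquiv x _).symm.trans (kerEquiv e _ he)⟩⟩

end Conjugate

end

theorem mainTheorem5_general {k : Type u} [Field k] {Gt : Type v} [Group Gt] [Finite Gt]
    (G : Subgroup Gt) [G.Normal] (M : Type w) [AddCommGroup M] [Module (MonoidAlgebra k G) M]
    [Module.Finite (MonoidAlgebra k G) M] :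
    (∀ x : Gt, Nonempty (ConjMod x M ≃ₗ[MonoidAlgebra k G] M) →
      Nonempty (ConjMod x (ProjCover (MonoidAlgebra k G) M) ≃ₗ[MonoidAlgebra k G]
        ProjCover (MonoidAlgebra k G) M) ∧
      Nonempty (ConjMod x (Syzygy (MonoidAlgebra k G) M) ≃ₗ[MonoidAlgebra k G]
        Syzygy (MonoidAlgebra k G) M)) ∧
    Nonempty (Ind k G (Syzygy (MonoidAlgebra k G) M) ≃ₗ[MonoidAlgebra k Gt]
      Syzygy (MonoidAlgebra k Gt) (Ind k G M)) ∧
    Nonempty (ARTranslate (MonoidAlgebra k Gt) (Ind k G M) k ≃ₗ[MonoidAlgebra k Gt]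
      Ind k G (ARTranslate (MonoidAlgebra k G) M k)) := by
  have := Fintype.ofFinite (Gt ⧸ G)
  let F := groupAlgebraFrobeniusSystem k G
  have hF : F.IsNormal := groupAlgebraFrobeniusSystem_isNormal k G
  have algebraMap_comm (c : k) : MonoidAlgebra.mapDomainRingHom k G.subtype
      (algebraMap k (MonoidAlgebra k G) c) = algebraMap k (MonoidAlgebra k Gt) c :=
    RingHom.congr_fun (MonoidAlgebra.mapDomainRingHom_comp_algebraMap G.subtype) c
  obtain ⟨syzygy⟩ := (F.baseChange M).nonempty_syzygy hF
  obtain ⟨arTranslate⟩ := (F.baseChange M).nonempty_arTranslate algebraMap_comm hF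
  exact ⟨fun x ⟨h⟩ => nonempty_conjMod_projCover_and_syzygy k G M x h,
    ⟨(F.baseChange _).equiv syzygy⟩, ⟨arTranslate.equiv (F.baseChange _)⟩⟩

theorem mainTheorem5 {k : Type u} [Field k] [IsAlgClosed k] (p : ℕ) (hp : 0 < p) [CharP k p]
    {Gt : Type v} [Group Gt] [Finite Gt] (G : Subgroup Gt) [G.Normal]
    (M : Type w) [AddCommGroup M] [Module (MonoidAlgebra k G) M]
    [Module.Finite (MonoidAlgebra k G) M]
    (hM : ∀ x : Gt, Nonempty (ConjMod x M ≃ₗ[MonoidAlgebra k G] M)) :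
    (∀ x : Gt, Nonempty (ConjMod x (ProjCover (MonoidAlgebra k G) M) ≃ₗ[MonoidAlgebra k G]
      ProjCover (MonoidAlgebra k G) M)) ∧
    (∀ x : Gt, Nonempty (ConjMod x (Syzygy (MonoidAlgebra k G) M) ≃ₗ[MonoidAlgebra k G]
      Syzygy (MonoidAlgebra k G) M)) ∧
    Nonempty (Ind k G (Syzygy (MonoidAlgebra k G) M) ≃ₗ[MonoidAlgebra k Gt]
      Syzygy (MonoidAlgebra k Gt) (Ind k G M)) ∧
    Nonempty (ARTranslate (MonoidAlgebra k Gt) (Ind k G M) k ≃ₗ[MonoidAlgebra k Gt]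
      Ind k G (ARTranslate (MonoidAlgebra k G) M k)) := by
  obtain ⟨conj, ind⟩ := mainTheorem5_general (k := k) G M
  exact ⟨fun x => (conj x (hM x)).1, fun x => (conj x (hM x)).2, ind⟩
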